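/- A pair of real constants $a,b>0$ is called *Coppersmith–Rivlin* if for all integers $n\ge 1$ and every real polynomial $p$ of degree $d\le n$ with $|p(k)|\le 1$ for all integers $k\in[0,n]$, one has $|p(x)|<a\,e^{bd^2/n}$ for all real $x\in[0,n]$. A quantum search algorithm with $T$ queries on a black-box $x\in\{0,1\}^N$ prepares the state $U_TOU_{T-1}O\cdots OU_1OU_0|\vec 0\rangle$, where the unitaries $U_i$ on a finite-dimensional space do not depend on $x$ and $O$ is the query gate $|j,c\rangle\mapsto|j,c\oplus x_j\rangle$, measures it in the computational basis, and from the result outputs either an index $j$ or the answer "no". An index $j$ is a solution if $x_j=1$. **Theorem.** Coppersmith–Rivlin pairs exist. Let $(a,b)$ be any such pair. 1. Let $1\le t<N$ be integers, let $s$ be a real polynomial of degree $d\le N-t$ with $s(0)=0$, and let $\varepsilon$ be real with $1-\varepsilon\le s(k)\le 1$ for all integers $k\in[t,N]$. Then $$\varepsilon\ \ge\ \frac1a\,e^{-bd^2/(N-t)-4d\sqrt{tN/(N-t)^2}}.$$ 2. There is a constant $c>0$, independent of $N$, $t$, $T$, $\varepsilon$ and the algorithm, such that for all integers $1\le t<N$: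 (i) If $0\le T\le N-t$ and a quantum search algorithm with $T$ queries errs with probability at most $\varepsilon$ on every black-box that has either no solutions (where the correct answer is "no") or at least $t$ solutions (where a correct answer is a solution), then $$\varepsilon\ \ge\ c\,e^{-4bT^2/(N-t)-8T\sqrt{tN/(N-t)^2}}.$$ (ii) If a quantum search algorithm outputs a solution with probability at least $1-\varepsilon$ on every black-box with at least $t$ solutions, with no requirement on other black-boxes, then the bound in (i) holds with $T$ equal to the number of its queries plus one (the query that tests the index found), provided that this $T$ is at most $N-t$. -/

import Mathlib

noncomputable section

/-- A quantum algorithm that makes exactly `T` queries to a black-box `x ∈ {0,1}^N` and returns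
an element of `Out`. Its basis states are `|j, b, z⟩` with an address `j`, a target bit `b` and a
workspace `z`. The address register may be larger than `N` (as when it consists of qubits).
The gates `U 0, …, U T` are unitary and do not depend on `x`; at the end the state is measured in
the computational basis, and `out` reads the answer off the measured basis state. -/
structure QueryAlgorithm (N T : ℕ) (Out : Type) where
  m : ℕ
  w : ℕ
  le_addr : N ≤ m + 1
  U : Fin (T + 1) → Matrix.unitaryGroup (Fin (m + 1) × Bool × Fin (w + 1)) ℂ
  out : Fin (m + 1) × Bool × Fin (w + 1) → Out

namespace QueryAlgorithm

variable {N T : ℕ} {Out : Type}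

/-- The computational basis states. -/
abbrev Basis (A : QueryAlgorithm N T Out) : Type := Fin (A.m + 1) × Bool × Fin (A.w + 1)

/-- The query on basis states: `|j, b, z⟩ ↦ |j, b ⊕ x_j, z⟩`; addresses `j ≥ N` are unaffected. -/
def queryBasis (A : QueryAlgorithm N T Out) (x : Fin N → Bool) (s : A.Basis) : A.Basis :=
  (s.1, xor s.2.1 (if h : (s.1 : ℕ) < N then x ⟨s.1, h⟩ else false), s.2.2)

/-- The query gate, extended linearly to state vectors (`queryBasis` is an involution, so the new
amplitude at `s` is the old amplitude at `queryBasis x s`). -/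
def query (A : QueryAlgorithm N T Out) (x : Fin N → Bool) (v : A.Basis → ℂ) : A.Basis → ℂ :=
  fun s => v (A.queryBasis x s)

/-- `state x k` is the state `U_k O U_{k-1} O ⋯ O U_0 |0⟩`, after `k` queries. -/
def state (A : QueryAlgorithm N T Out) (x : Fin N → Bool) : Fin (T + 1) → A.Basis → ℂ :=
  Fin.induction (motive := fun _ => A.Basis → ℂ)
    (Matrix.mulVec (A.U 0 : Matrix A.Basis A.Basis ℂ) (Pi.single (0, false, 0) 1))
    (fun i v => Matrix.mulVec (A.U i.succ : Matrix A.Basis A.Basis ℂ) (A.query x v))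

open Classical in
/-- The probability that on black-box `x` the answer of the algorithm lies in `E`. -/
def prob (A : QueryAlgorithm N T Out) (x : Fin N → Bool) (E : Set Out) : ℝ :=
  ∑ s : A.Basis, if A.out s ∈ E then ‖A.state x (Fin.last T) s‖ ^ 2 else 0

end QueryAlgorithm

/-- The answers that are solutions of the search problem on `x`: an index `j` with `x_j = 1`.
The answer `none` stands for "no". -/
def solutions {N : ℕ} (x : Fin N → Bool) : Set (Option (Fin N)) :=
  {o | ∃ j : Fin N, o = some j ∧ x j = true}

/-- On every black-box with at least `t` solutions, `A` returns a solution except with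
probability at most `ε`. Nothing is required on any other black-box. -/
def FindsWithError {N T : ℕ} (A : QueryAlgorithm N T (Option (Fin N))) (t : ℕ) (ε : ℝ) : Prop :=
  ∀ x : Fin N → Bool, t ≤ (Finset.univ.filter fun j => x j = true).card →
    1 - ε ≤ A.prob x (solutions x)

/-- `A` solves the search problem with error at most `ε` under the promise that there are either
no solutions (then it has to answer "no") or at least `t` of them. -/
def SearchesWithError {N T : ℕ} (A : QueryAlgorithm N T (Option (Fin N))) (t : ℕ) (ε : ℝ) : Prop :=
  1 - ε ≤ A.prob (fun _ => false) {none} ∧ FindsWithError A t ε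

/-- `a, b` are constants for the Coppersmith–Rivlin theorem: a real polynomial of degree `d ≤ n`
that is at most `1` in absolute value at the integers `0, …, n` is less than `a e^{b d² / n}` in
absolute value on the interval `[0, n]`. -/
def IsCoppersmithRivlin (a b : ℝ) : Prop :=
  0 < a ∧ 0 < b ∧
    ∀ (n : ℕ) (p : Polynomial ℝ), 1 ≤ n → p.natDegree ≤ n →
      (∀ k : ℕ, k ≤ n → |p.eval (k : ℝ)| ≤ 1) →
      ∀ x : ℝ, 0 ≤ x → x ≤ n → |p.eval x| < a * Real.exp (b * (p.natDegree : ℝ) ^ 2 / n)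

end

/-!
**Coppersmith–Rivlin pairs exist.** Let `p` have degree `d`, with `|p| ≤ 1` at the integers of
`[0, n]`. If `d` is at least a fixed fraction of `n`, Lagrange interpolation at all the integers
gives a bound exponential in `n`, which is of order `d² / n` then. Otherwise reflect and translate
so that the point lies in `[0, 1]` and there are still `n / 2` integers to its right, and
interpolate at the nodes `8 R j² + r` with `r < R`, where `R` is of order `1 + d² / n`
(`blockNode`). These copy, as far as integers can, the quadratic spacing of Chebyshev nodes near
an endpoint. For exact squares as nodes, the Lagrange basis polynomials on `[0, 1]` are bounded by
a multiple of `1 / j²`, as `∏_{i ≠ j} |j² - i²| = (J + j)! (J - j)! / 2`; replacing squares by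
blocks perturbs each factor `j² - i²` relatively by at most `1 / (8 |j² - i²|)`, and these numbers
have a bounded sum. So each block position costs a constant factor only, and the Lebesgue function
is at most exponential in `R` (`abs_eval_le_of_blocks`).

**The polynomial bound.** If `|Q| ≤ δ` at the integers of `[t, N]`, then `|Q|` is at most
`δ a exp (b d² / (N - t))` on the real interval, and the extremal growth of the Chebyshev
polynomial `T_d` bounds `Q 0` (`IsCoppersmithRivlin.eval_zero_le`). The first part is the case
`Q = 1 - s`.

**Quantum search.** The amplitudes after `T` queries are multilinear polynomials of degree at most
`T` in the bits of the black-box (`QueryAlgorithm.state_mem_lowDegree`). The part of the final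
state that gives a wrong answer on black-boxes with many solutions has norm at least `√(1 - ε)`
without solutions, and at most `√ε` with `t` solutions or more. Its inner product with its own value
at the zero black-box, averaged over the black-boxes with `k` solutions, is a polynomial in `k` of
degree at most `T`, to which the growth bound applies
(`IsCoppersmithRivlin.amplitude_error_ge`). Acceptance probabilities have degree `2 T`, which may
exceed `N - t`; amplitudes cover the full range `T ≤ N - t`.
-/

noncomputable section
open Finset Polynomial

/-! ### Products over quadratic nodes -/

@[to_additive]
theorem prod_range_erase {M : Type*} [CommMonoid M] (f : ℕ → M) (j m : ℕ) :
    ∏ i ∈ (range (j + m + 1)).erase j, f i =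
      (∏ i ∈ range j, f i) * ∏ i ∈ range m, f (j + 1 + i) := by
  have h : (range (j + m + 1)).erase j = (range (j + 1 + m)).erase j := by
    congr 2; ring
  have h2 : ∏ i ∈ (range (j + m + 1)).erase j, f i =
      ∏ i ∈ range (j + 1 + m), if i = j then 1 else f i := by
    rw [h, ← prod_erase (range (j + 1 + m)) (a := j) (by simp)]
    refine prod_congr rfl fun i hi => ?_
    rw [if_neg (ne_of_mem_erase hi)]
  rw [h2, prod_range_add, prod_range_succ, if_pos rfl, mul_one]
  congr 1
  · exact prod_congr rfl fun i hi => by rw [if_neg (mem_range.1 hi).ne]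
  · exact prod_congr rfl fun i _ => by rw [if_neg (by omega)]

theorem one_sub_sum_le_prod_one_sub {ι : Type*} (s : Finset ι) (a : ι → ℝ)
    (h0 : ∀ i ∈ s, 0 ≤ a i) (h1 : ∀ i ∈ s, a i ≤ 1) :
    1 - ∑ i ∈ s, a i ≤ ∏ i ∈ s, (1 - a i) := by
  classical
  induction s using Finset.induction_on with
  | empty => simp
  | insert i s hi ih =>
    rw [sum_insert hi, prod_insert hi]
    have ih' := ih (fun k hk => h0 k (mem_insert_of_mem hk)) (fun k hk => h1 k (mem_insert_of_mem hk))
    have hs : 0 ≤ ∑ k ∈ s, a k := sum_nonneg fun k hk => h0 k (mem_insert_of_mem hk)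
    have := h0 i (mem_insert_self _ _)
    have := h1 i (mem_insert_self _ _)
    nlinarith

theorem sum_range_inv_succ_sq_le_two (m : ℕ) :
    ∑ i ∈ range m, (1 : ℝ) / ((i : ℝ) + 1) ^ 2 ≤ 2 := by
  have h : ∑ i ∈ range m, (1 : ℝ) / ((i : ℝ) + 1) ^ 2 ≤ 2 - 1 / (m : ℝ) := by
    induction m with
    | zero => norm_num
    | succ m ih =>
      rw [sum_range_succ]
      rcases Nat.eq_zero_or_pos m with rfl | hpos
      · norm_num
      have hm : (0 : ℝ) < m := by exact_mod_cast hpos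
      have h1 : (1 : ℝ) / ((m : ℝ) + 1) ^ 2 ≤ 1 / (m : ℝ) - 1 / (m + 1) := by
        rw [div_sub_div _ _ hm.ne' (by positivity),
          div_le_div_iff₀ (by positivity) (by positivity)]
        nlinarith
      push_cast
      linarith
  have : 0 ≤ 1 / (m : ℝ) := by positivity
  linarith

theorem abs_sq_sub_sq_ge (i j : ℕ) :
    ((i : ℝ) - j) ^ 2 ≤ |(j : ℝ) ^ 2 - (i : ℝ) ^ 2| := by
  have hi : (0 : ℝ) ≤ i := i.cast_nonneg
  have hj : (0 : ℝ) ≤ j := j.cast_nonneg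
  rcases le_total (i : ℝ) j with h | h
  · exact le_trans (by nlinarith) (le_abs_self _)
  · exact le_trans (by nlinarith) (neg_le_abs _)

theorem one_le_abs_sq_sub_sq {i j : ℕ} (h : i ≠ j) :
    1 ≤ |(j : ℝ) ^ 2 - (i : ℝ) ^ 2| := by
  have h1 : ((j : ℤ) ^ 2 - (i : ℤ) ^ 2) ≠ 0 := by
    intro h0
    have : (j : ℤ) ^ 2 = (i : ℤ) ^ 2 := by linarith
    have := (sq_eq_sq₀ (by positivity) (by positivity)).1 this
    exact h (by exact_mod_cast this.symm)
  have h2 := Int.one_le_abs h1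
  have : ((1 : ℤ) : ℝ) ≤ ((|(j : ℤ) ^ 2 - (i : ℤ) ^ 2| : ℤ) : ℝ) := by exact_mod_cast h2
  simpa using this

theorem sum_inv_abs_sq_sub_sq_le (j m : ℕ) :
    ∑ i ∈ (range (j + m + 1)).erase j, 1 / |(j : ℝ) ^ 2 - (i : ℝ) ^ 2| ≤ 4 := by
  have h : ∑ i ∈ (range (j + m + 1)).erase j, 1 / |(j : ℝ) ^ 2 - (i : ℝ) ^ 2| ≤
      ∑ i ∈ (range (j + m + 1)).erase j, 1 / ((i : ℝ) - j) ^ 2 := by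
    refine sum_le_sum fun i hi => ?_
    have : (i : ℝ) - j ≠ 0 := sub_ne_zero.2 (by exact_mod_cast ne_of_mem_erase hi)
    exact one_div_le_one_div_of_le (by positivity) (abs_sq_sub_sq_ge i j)
  refine h.trans ?_
  rw [sum_range_erase, ← sum_range_reflect]
  have h1 : ∑ i ∈ range j, 1 / (((j - 1 - i : ℕ) : ℝ) - j) ^ 2 ≤ 2 := by
    refine le_trans (le_of_eq (sum_congr rfl fun i hi => ?_)) (sum_range_inv_succ_sq_le_two j)
    have hi := mem_range.1 hi
    rw [Nat.sub_sub, Nat.cast_sub (by omega)]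
    congr 1
    push_cast; ring
  have h2 : ∑ i ∈ range m, 1 / (((j + 1 + i : ℕ) : ℝ) - j) ^ 2 ≤ 2 := by
    refine le_trans (le_of_eq (sum_congr rfl fun i hi => ?_)) (sum_range_inv_succ_sq_le_two m)
    congr 1
    push_cast; ring
  linarith

theorem factorial_two_mul_le_prod (j : ℕ) :
    ((2 * j).factorial : ℝ) ≤ 2 * (j.factorial * ∏ i ∈ range j, ((j : ℝ) + i)) := by
  rcases Nat.eq_zero_or_pos j with rfl | hj
  · norm_num
  have h1 : ((2 * j).factorial : ℝ) = j.factorial * ∏ i ∈ range j, ((j : ℝ) + 1 + i) := by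
    rw [two_mul, ← Nat.factorial_mul_ascFactorial, Nat.ascFactorial_eq_prod_range]
    push_cast; rfl
  have h2 : (j : ℝ) * ∏ i ∈ range j, ((j : ℝ) + 1 + i) =
      j * (2 * ∏ i ∈ range j, ((j : ℝ) + i)) := by
    have a := prod_range_succ (fun i : ℕ => (j : ℝ) + i) j
    have b := prod_range_succ' (fun i : ℕ => (j : ℝ) + i) j
    have c : ∏ i ∈ range j, ((j : ℝ) + 1 + i) = ∏ i ∈ range j, ((j : ℝ) + ((i + 1 : ℕ) : ℝ)) :=
      prod_congr rfl fun i _ => by push_cast; ring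
    rw [c]
    rw [a] at b
    simp only [Nat.cast_zero, add_zero] at b
    linarith
  have hj' : (j : ℝ) ≠ 0 := by positivity
  rw [h1, mul_left_cancel₀ hj' h2]
  exact le_of_eq (by ring)

/-- With `J = j + m`, the product over `i ≠ j` in `[0, J]` is `(J + j)! (J - j)! / 2`
unless `j = 0`. -/
theorem factorial_add_mul_factorial_le_prod (j m : ℕ) :
    ((2 * j + m).factorial : ℝ) * m.factorial ≤
      2 * ∏ i ∈ (range (j + m + 1)).erase j, |(j : ℝ) ^ 2 - (i : ℝ) ^ 2| := by
  rw [prod_range_erase]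
  have h1 : ∏ i ∈ range j, |(j : ℝ) ^ 2 - (i : ℝ) ^ 2| =
      j.factorial * ∏ i ∈ range j, ((j : ℝ) + i) := by
    have e : (j.factorial : ℝ) = ∏ i ∈ range j, ((j : ℝ) - i) := by
      rw [← Nat.descFactorial_self, Nat.descFactorial_eq_prod_range, Nat.cast_prod]
      exact prod_congr rfl fun i hi => Nat.cast_sub (mem_range.1 hi).le
    rw [e, ← prod_mul_distrib]
    refine prod_congr rfl fun i hi => ?_
    have : (i : ℝ) ≤ j := by exact_mod_cast (mem_range.1 hi).le
    have h0 : (0 : ℝ) ≤ i := i.cast_nonneg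
    rw [abs_of_nonneg (by nlinarith)]
    ring
  have h2 : ∀ i : ℕ, |(j : ℝ) ^ 2 - ((j + 1 + i : ℕ) : ℝ) ^ 2| =
      ((i : ℝ) + 1) * (2 * j + i + 1) := fun i => by
    have h0 : (0 : ℝ) ≤ i := i.cast_nonneg
    have h0' : (0 : ℝ) ≤ j := j.cast_nonneg
    push_cast
    rw [abs_of_nonpos (by nlinarith)]
    ring
  rw [h1]
  simp only [h2]
  induction m with
  | zero => simpa using factorial_two_mul_le_prod j
  | succ m ih =>
    rw [prod_range_succ, ← add_assoc, Nat.factorial_succ, Nat.factorial_succ]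
    push_cast
    have h3 : (0 : ℝ) ≤ (m + 1) * (2 * j + m + 1) := by positivity
    calc _ = ((2 * j + m).factorial : ℝ) * m.factorial * ((m + 1) * (2 * j + m + 1)) := by ring
      _ ≤ _ := mul_le_mul_of_nonneg_right ih h3
      _ = _ := by ring

theorem sq_factorial_add_le (j m : ℕ) :
    ((j + m).factorial : ℝ) ^ 2 ≤ (2 * j + m).factorial * m.factorial := by
  have h : (j + m).factorial ^ 2 ≤ (2 * j + m).factorial * m.factorial := by
    have h1 : (2 * j + m).factorial = (j + m).factorial * (j + m + 1).ascFactorial j := by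
      rw [Nat.factorial_mul_ascFactorial]; congr 1; ring
    have h2 : (j + m).factorial = m.factorial * (m + 1).ascFactorial j := by
      rw [Nat.factorial_mul_ascFactorial]; congr 1; ring
    have h3 : (m + 1).ascFactorial j ≤ (j + m + 1).ascFactorial j := by
      rw [Nat.ascFactorial_eq_prod_range, Nat.ascFactorial_eq_prod_range]
      exact prod_le_prod' fun i _ => by omega
    calc (j + m).factorial ^ 2 = (j + m).factorial * (m.factorial * (m + 1).ascFactorial j) := by
          rw [← h2, sq]
      _ ≤ (j + m).factorial * (m.factorial * (j + m + 1).ascFactorial j) := by gcongr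
      _ = _ := by rw [h1]; ring
  exact_mod_cast h

theorem prod_eight_sq_add_one_le (J : ℕ) :
    ∏ i ∈ range (J + 1), (8 * (i : ℝ) ^ 2 + 1) ≤ 2 * (8 ^ J * (J.factorial : ℝ) ^ 2) := by
  have h : ∏ i ∈ range (J + 1), (8 * (i : ℝ) ^ 2 + 1) ≤
      (2 - 1 / (J + 1)) * (8 ^ J * (J.factorial : ℝ) ^ 2) := by
    induction J with
    | zero => norm_num
    | succ J ih =>
      rw [prod_range_succ, Nat.factorial_succ, pow_succ (8 : ℝ) J]
      have hJ : (0 : ℝ) ≤ J := J.cast_nonneg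
      have h1 : (2 - 1 / ((J : ℝ) + 1)) * (8 * ((J : ℝ) + 1) ^ 2 + 1) ≤
          (2 - 1 / ((J : ℝ) + 1 + 1)) * (8 * ((J : ℝ) + 1) ^ 2) := by
        rw [← sub_nonneg]
        have : (2 - 1 / ((J : ℝ) + 1 + 1)) * (8 * ((J : ℝ) + 1) ^ 2) -
          (2 - 1 / ((J : ℝ) + 1)) * (8 * ((J : ℝ) + 1) ^ 2 + 1) =
          (8 * (J + 1) / (J + 2) - 2) + 1 / (J + 1) := by
          field_simp; ring
        rw [this]
        have : 2 ≤ 8 * ((J : ℝ) + 1) / (J + 2) := by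
          rw [le_div_iff₀ (by positivity)]; linarith
        have : 0 ≤ 1 / ((J : ℝ) + 1) := by positivity
        linarith
      push_cast
      calc _ ≤ (2 - 1 / ((J : ℝ) + 1)) * (8 ^ J * (J.factorial : ℝ) ^ 2) *
            (8 * ((J : ℝ) + 1) ^ 2 + 1) :=
            mul_le_mul_of_nonneg_right ih (by positivity)
        _ = (8 ^ J * (J.factorial : ℝ) ^ 2) *
          ((2 - 1 / ((J : ℝ) + 1)) * (8 * ((J : ℝ) + 1) ^ 2 + 1)) := by ring
        _ ≤ (8 ^ J * (J.factorial : ℝ) ^ 2) *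
          ((2 - 1 / ((J : ℝ) + 1 + 1)) * (8 * ((J : ℝ) + 1) ^ 2)) := by gcongr
        _ = _ := by ring
  refine h.trans ?_
  gcongr
  have : (0 : ℝ) ≤ 1 / (J + 1) := by positivity
  linarith

/-- The estimate behind the Lagrange bound: on the left bounds for `|x - v|`, one node `v` in each
block, on the right lower bounds for the distances between nodes of different blocks, all divided by `R`. -/
theorem prod_node_numerator_le (j m : ℕ) :
    ∏ i ∈ range (j + m + 1), (8 * (i : ℝ) ^ 2 + 1) ≤
      8 * ∏ i ∈ (range (j + m + 1)).erase j, (8 * |(j : ℝ) ^ 2 - (i : ℝ) ^ 2| - 1) := by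
  set E := (range (j + m + 1)).erase j with hE
  have hcard : E.card = j + m := by
    rw [hE, card_erase_of_mem (mem_range.2 (by omega)), card_range]; omega
  have hone : ∀ i ∈ E, 1 ≤ |(j : ℝ) ^ 2 - (i : ℝ) ^ 2| := fun i hi =>
    one_le_abs_sq_sub_sq (ne_of_mem_erase hi)
  have h1 : ∏ i ∈ E, (8 * |(j : ℝ) ^ 2 - (i : ℝ) ^ 2| - 1) =
      8 ^ (j + m) * (∏ i ∈ E, |(j : ℝ) ^ 2 - (i : ℝ) ^ 2|) *
        ∏ i ∈ E, (1 - 1 / (8 * |(j : ℝ) ^ 2 - (i : ℝ) ^ 2|)) := by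
    rw [← hcard, ← prod_const, ← prod_mul_distrib, ← prod_mul_distrib]
    refine prod_congr rfl fun i hi => ?_
    have := hone i hi
    have h0 : |(j : ℝ) ^ 2 - (i : ℝ) ^ 2| ≠ 0 := by linarith
    field_simp
  have h2 : (1 : ℝ) / 2 ≤ ∏ i ∈ E, (1 - 1 / (8 * |(j : ℝ) ^ 2 - (i : ℝ) ^ 2|)) := by
    refine le_trans ?_ (one_sub_sum_le_prod_one_sub E _ (fun i _ => by positivity)
      fun i hi => ?_)
    · have h3 : ∑ i ∈ E, 1 / (8 * |(j : ℝ) ^ 2 - (i : ℝ) ^ 2|) =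
          1 / 8 * ∑ i ∈ E, 1 / |(j : ℝ) ^ 2 - (i : ℝ) ^ 2| := by
        rw [mul_sum]
        exact sum_congr rfl fun i _ => by rw [div_mul_div_comm, one_mul]
      have := sum_inv_abs_sq_sub_sq_le j m
      rw [h3]
      linarith
    · have := hone i hi
      rw [div_le_one (by positivity)]
      linarith
  have h3 := factorial_add_mul_factorial_le_prod j m
  have h4 := sq_factorial_add_le j m
  refine (prod_eight_sq_add_one_le (j + m)).trans ?_
  rw [h1]
  have h5 : 0 ≤ ∏ i ∈ E, |(j : ℝ) ^ 2 - (i : ℝ) ^ 2| := prod_nonneg fun i _ => abs_nonneg _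
  calc 2 * (8 ^ (j + m) * ((j + m).factorial : ℝ) ^ 2)
      ≤ 2 * (8 ^ (j + m) * (2 * ∏ i ∈ E, |(j : ℝ) ^ 2 - (i : ℝ) ^ 2|)) := by
        gcongr; exact h4.trans h3
    _ = 8 * (8 ^ (j + m) * (∏ i ∈ E, |(j : ℝ) ^ 2 - (i : ℝ) ^ 2|) * (1 / 2)) := by ring
    _ ≤ _ := by gcongr

/-! ### Interpolation at blocks of integers -/

/-- The interpolation nodes: the block of `R` consecutive integers that starts at `8 R j²`, one
block for each `j`. -/
def blockNode (R : ℕ) (q : ℕ × ℕ) : ℕ := 8 * R * q.1 ^ 2 + q.2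

theorem abs_sub_blockNode_ge {R : ℕ} {q q' : ℕ × ℕ} (h : q.2 < R) (h' : q'.2 < R) :
    R * (8 * |(q.1 : ℝ) ^ 2 - (q'.1 : ℝ) ^ 2| - 1) ≤
      |(blockNode R q : ℝ) - blockNode R q'| := by
  have e : (blockNode R q : ℝ) - blockNode R q' =
      8 * R * ((q.1 : ℝ) ^ 2 - (q'.1 : ℝ) ^ 2) - ((q'.2 : ℝ) - q.2) := by
    unfold blockNode; push_cast; ring
  have h1 : |(q'.2 : ℝ) - q.2| ≤ R := by
    have a : (q.2 : ℝ) ≤ R := by exact_mod_cast h.le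
    have b : (q'.2 : ℝ) ≤ R := by exact_mod_cast h'.le
    have c : (0 : ℝ) ≤ q.2 := by positivity
    have d : (0 : ℝ) ≤ q'.2 := by positivity
    rw [abs_le]; constructor <;> linarith
  have h2 := abs_sub_abs_le_abs_sub (8 * R * ((q.1 : ℝ) ^ 2 - (q'.1 : ℝ) ^ 2))
    ((q'.2 : ℝ) - q.2)
  rw [abs_mul, abs_of_nonneg (by positivity : (0 : ℝ) ≤ 8 * R)] at h2
  rw [e]
  linarith

theorem abs_sub_blockNode_pos {R : ℕ} {q q' : ℕ × ℕ} (h : q.2 < R) (h' : q'.2 < R)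
    (hne : q ≠ q') : 0 < |(blockNode R q : ℝ) - blockNode R q'| := by
  by_cases h1 : q.1 = q'.1
  · have h2 : q.2 ≠ q'.2 := fun h2 => hne (Prod.ext h1 h2)
    have e : (blockNode R q : ℝ) - blockNode R q' = (q.2 : ℝ) - q'.2 := by
      unfold blockNode; rw [h1]; push_cast; ring
    rw [e, abs_pos, sub_ne_zero]
    exact_mod_cast h2
  · refine lt_of_lt_of_le ?_ (abs_sub_blockNode_ge h h')
    have := one_le_abs_sq_sub_sq (Ne.symm h1)
    have hR : (0 : ℝ) < R := by exact_mod_cast (Nat.zero_le _).trans_lt h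
    exact mul_pos hR (by linarith)

theorem abs_sub_blockNode_le {R : ℕ} {q : ℕ × ℕ} (h : q.2 < R) {x : ℝ} (hx : 0 ≤ x)
    (hxR : x ≤ R) : |x - blockNode R q| ≤ R * (8 * (q.1 : ℝ) ^ 2 + 1) := by
  have a : (q.2 : ℝ) ≤ R := by exact_mod_cast h.le
  have b : (0 : ℝ) ≤ q.2 := by positivity
  have c : (0 : ℝ) ≤ 8 * R * (q.1 : ℝ) ^ 2 := by positivity
  unfold blockNode
  push_cast
  rw [abs_le]; constructor <;> nlinarith

/-- The factors of a Lagrange basis polynomial that belong to the block of its own node: the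
denominator is `r! (R - 1 - r)!`, and `R ^ k / k! ≤ e ^ R`. -/
theorem prod_within_block_le {R r : ℕ} (hr : r < R) {B : ℝ} (hB : 0 ≤ B) :
    ∏ i ∈ (range R).erase r, (R * B / |(r : ℝ) - i|) ≤ Real.exp (2 * R) * B ^ (R - 1) := by
  obtain ⟨m, rfl⟩ : ∃ m, R = r + m + 1 := ⟨R - r - 1, by omega⟩
  have hden : ∏ i ∈ (range (r + m + 1)).erase r, |(r : ℝ) - i| = r.factorial * m.factorial := by
    rw [prod_range_erase]
    congr 1
    · rw [← Nat.descFactorial_self, Nat.descFactorial_eq_prod_range, Nat.cast_prod]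
      refine prod_congr rfl fun i hi => ?_
      have : (i : ℝ) ≤ r := by exact_mod_cast (mem_range.1 hi).le
      rw [Nat.cast_sub (mem_range.1 hi).le, abs_of_nonneg (by linarith)]
    · rw [← prod_range_add_one_eq_factorial, Nat.cast_prod]
      refine prod_congr rfl fun i _ => ?_
      have : (0 : ℝ) ≤ i := by positivity
      push_cast
      rw [abs_of_nonpos (by linarith)]
      ring
  rw [prod_div_distrib, prod_const, hden, card_erase_of_mem (mem_range.2 hr), card_range,
    Nat.add_sub_cancel]
  set x : ℝ := ((r + m + 1 : ℕ) : ℝ) with hx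
  have hx0 : 0 ≤ x := by positivity
  have e : (x * B) ^ (r + m) / (r.factorial * m.factorial) =
      (x ^ r / r.factorial) * (x ^ m / m.factorial) * B ^ (r + m) := by
    rw [mul_pow, pow_add x]; field_simp
  rw [e, two_mul, Real.exp_add]
  gcongr
  · exact Real.pow_div_factorial_le_exp x hx0 r
  · exact Real.pow_div_factorial_le_exp x hx0 m

/-- On `[0, R]` the Lagrange basis polynomials of the block nodes are bounded by `(8 e²)^R`, with
a summable decay in the number `j` of the block and no loss in the number of blocks. -/
theorem abs_lagrange_basis_le {R J : ℕ} {q : ℕ × ℕ} (hq : q ∈ range (J + 1) ×ˢ range R) {x : ℝ}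
    (hx : 0 ≤ x) (hxR : x ≤ R) :
    |(Lagrange.basis (range (J + 1) ×ˢ range R) (fun q => (blockNode R q : ℝ)) q).eval x| ≤
      8 ^ R * Real.exp (2 * R) * (1 / (8 * (q.1 : ℝ) ^ 2 + 1)) := by
  obtain ⟨j, r⟩ := q
  obtain ⟨hj, hr⟩ : j < J + 1 ∧ r < R := by simpa using hq
  have hR : (0 : ℝ) < R := by exact_mod_cast (Nat.zero_le _).trans_lt hr
  set G : ℕ × ℕ → ℝ := fun q' => if q' = (j, r) then 1 else
    |x - blockNode R q'| / |(blockNode R (j, r) : ℝ) - blockNode R q'| with hG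
  have hG0 : ∀ q', 0 ≤ G q' := fun q' => by
    simp only [hG]; split_ifs <;> positivity
  have e1 : |(Lagrange.basis (range (J + 1) ×ˢ range R) (fun q => (blockNode R q : ℝ))
      (j, r)).eval x| = ∏ q' ∈ range (J + 1) ×ˢ range R, G q' := by
    rw [← prod_erase _ (a := (j, r)) (by simp [hG]), Lagrange.basis, eval_prod, abs_prod]
    refine prod_congr rfl fun q' hq' => ?_
    rw [hG]
    simp only [if_neg (ne_of_mem_erase hq')]
    simp [Lagrange.basisDivisor, abs_mul, abs_inv, div_eq_inv_mul]
  rw [e1, prod_product, ← mul_prod_erase _ _ (mem_range.2 hj)]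
  have hP : ∀ i ∈ (range (J + 1)).erase j, ∏ s ∈ range R, G (i, s) ≤
      ((8 * (i : ℝ) ^ 2 + 1) / (8 * |(j : ℝ) ^ 2 - (i : ℝ) ^ 2| - 1)) ^ R := by
    intro i hi
    have hne := ne_of_mem_erase hi
    have hone := one_le_abs_sq_sub_sq hne
    have hc : ((8 * (i : ℝ) ^ 2 + 1) / (8 * |(j : ℝ) ^ 2 - (i : ℝ) ^ 2| - 1)) ^ R =
      ∏ s ∈ range R, ((8 * (i : ℝ) ^ 2 + 1) / (8 * |(j : ℝ) ^ 2 - (i : ℝ) ^ 2| - 1)) := by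
      rw [prod_const, card_range]
    rw [hc]
    refine prod_le_prod (fun s _ => hG0 _) fun s hs => ?_
    have hs := mem_range.1 hs
    simp only [hG]
    rw [if_neg (by simp [hne]), ← mul_div_mul_left (8 * (i : ℝ) ^ 2 + 1) _ hR.ne']
    have hpos : 0 < R * (8 * |(j : ℝ) ^ 2 - (i : ℝ) ^ 2| - 1) := mul_pos hR (by linarith)
    gcongr
    · exact abs_sub_blockNode_le (q := (i, s)) hs hx hxR
    · exact abs_sub_blockNode_ge (q := (j, r)) (q' := (i, s)) hr hs
  have hA : ∏ s ∈ range R, G (j, s) ≤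
      Real.exp (2 * R) * (8 * (j : ℝ) ^ 2 + 1) ^ (R - 1) := by
    refine le_trans ?_ (prod_within_block_le hr (by positivity))
    rw [← prod_erase (range R) (a := r) (f := fun s => G (j, s)) (by simp [hG])]
    refine prod_le_prod (fun s _ => hG0 _) fun s hs => ?_
    have hne := ne_of_mem_erase hs
    have hs := mem_range.1 (mem_of_mem_erase hs)
    simp only [hG]
    rw [if_neg (by simp [hne])]
    have e : (blockNode R (j, r) : ℝ) - blockNode R (j, s) = (r : ℝ) - s := by
      unfold blockNode; push_cast; ring
    rw [e]
    gcongr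
    exact abs_sub_blockNode_le (q := (j, s)) hs hx hxR
  obtain ⟨m, rfl⟩ : ∃ m, J = j + m := ⟨J - j, by omega⟩
  set B : ℝ := 8 * (j : ℝ) ^ 2 + 1 with hB
  have hB0 : 0 < B := by positivity
  set D := ∏ i ∈ (range (j + m + 1)).erase j, (8 * |(j : ℝ) ^ 2 - (i : ℝ) ^ 2| - 1) with hD
  have hD0 : 0 < D := prod_pos fun i hi => by
    have := one_le_abs_sq_sub_sq (ne_of_mem_erase hi)
    linarith
  have hN0 : 0 ≤ ∏ i ∈ (range (j + m + 1)).erase j, (8 * (i : ℝ) ^ 2 + 1) :=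
    prod_nonneg fun i _ => by positivity
  have hnum := prod_node_numerator_le j m
  rw [← mul_prod_erase _ _ (mem_range.2 hj)] at hnum
  have hQ : ∏ i ∈ (range (j + m + 1)).erase j, ∏ s ∈ range R, G (i, s) ≤ (8 / B) ^ R := by
    refine (prod_le_prod (fun i _ => prod_nonneg fun s _ => hG0 _) hP).trans ?_
    rw [prod_pow, prod_div_distrib]
    refine pow_le_pow_left₀ (div_nonneg hN0 hD0.le) ?_ R
    rw [div_le_div_iff₀ hD0 hB0, mul_comm]
    exact hnum
  calc _ ≤ Real.exp (2 * R) * B ^ (R - 1) * (8 / B) ^ R :=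
        mul_le_mul hA hQ (prod_nonneg fun i _ => prod_nonneg fun s _ => hG0 _) (by positivity)
    _ = _ := by
        obtain ⟨k, rfl⟩ : ∃ k, R = k + 1 := ⟨R - 1, by omega⟩
        rw [Nat.add_sub_cancel, div_pow, pow_succ B]
        field_simp

theorem sum_inv_eight_sq_add_one_le (J : ℕ) :
    ∑ j ∈ range (J + 1), 1 / (8 * (j : ℝ) ^ 2 + 1) ≤ 2 := by
  rw [sum_range_succ']
  have h : ∑ k ∈ range J, 1 / (8 * ((k + 1 : ℕ) : ℝ) ^ 2 + 1) ≤
      1 / 8 * ∑ k ∈ range J, 1 / ((k : ℝ) + 1) ^ 2 := by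
    rw [mul_sum]
    refine sum_le_sum fun k _ => ?_
    rw [div_mul_div_comm, one_mul]
    push_cast
    exact one_div_le_one_div_of_le (by positivity) (by linarith)
  have := sum_range_inv_succ_sq_le_two J
  have e : 1 / (8 * ((0 : ℕ) : ℝ) ^ 2 + 1) = 1 := by norm_num
  linarith

/-- A polynomial bounded by `1` at the integers of `[0, n]` is bounded by `2 R (8 e²)^R` on
`[0, R]` if it is determined by its values at block nodes in `[0, n]`. -/
theorem abs_eval_le_of_blocks {R J n : ℕ} {p : ℝ[X]} (hdeg : p.natDegree < (J + 1) * R)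
    (hn : 8 * R * J ^ 2 + R ≤ n + 1) (hp : ∀ k : ℕ, k ≤ n → |p.eval (k : ℝ)| ≤ 1) {x : ℝ}
    (hx : 0 ≤ x) (hxR : x ≤ R) : |p.eval x| ≤ 2 * R * (8 ^ R * Real.exp (2 * R)) := by
  set S := range (J + 1) ×ˢ range R with hS
  set v : ℕ × ℕ → ℝ := fun q => (blockNode R q : ℝ) with hv
  have hinj : Set.InjOn v S := by
    intro q hq q' hq' h
    by_contra hne
    simp only [hS, coe_product, Set.mem_prod, coe_range, Set.mem_Iio] at hq hq'
    have := abs_sub_blockNode_pos hq.2 hq'.2 hne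
    rw [show (blockNode R q : ℝ) = blockNode R q' from h, sub_self, abs_zero] at this
    exact lt_irrefl _ this
  have hcard : p.degree < S.card := by
    rw [hS, card_product, card_range, card_range]
    exact lt_of_le_of_lt degree_le_natDegree (by exact_mod_cast hdeg)
  rw [Lagrange.eq_interpolate hinj hcard, Lagrange.interpolate_apply, eval_finsetSum]
  refine (abs_sum_le_sum_abs _ _).trans ?_
  have hterm : ∀ q ∈ S, |(C (p.eval (v q)) * Lagrange.basis S v q).eval x| ≤
      8 ^ R * Real.exp (2 * R) * (1 / (8 * (q.1 : ℝ) ^ 2 + 1)) := by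
    intro q hq
    rw [eval_mul, eval_C, abs_mul]
    have h1 : |p.eval (v q)| ≤ 1 := by
      apply hp
      have hq' : q.1 < J + 1 ∧ q.2 < R := by simpa [hS] using hq
      have : q.1 ^ 2 ≤ J ^ 2 := Nat.pow_le_pow_left (by omega) 2
      have := Nat.mul_le_mul_left (8 * R) this
      unfold blockNode
      omega
    calc _ ≤ 1 * |(Lagrange.basis S v q).eval x| := by gcongr
      _ ≤ _ := by rw [one_mul]; exact abs_lagrange_basis_le hq hx hxR
  refine (sum_le_sum hterm).trans ?_
  rw [← mul_sum, hS, sum_product]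
  simp only [sum_const, card_range, nsmul_eq_mul]
  rw [← mul_sum]
  have := sum_inv_eight_sq_add_one_le J
  calc _ ≤ 8 ^ R * Real.exp (2 * R) * (R * 2) := by gcongr
    _ = _ := by ring

theorem two_mul_mul_pow_le_exp (R : ℕ) :
    2 * R * (8 ^ R * Real.exp (2 * R)) ≤ 2 * Real.exp (6 * R) := by
  have h1 : (R : ℝ) ≤ Real.exp R := by
    have := Real.add_one_le_exp (R : ℝ); linarith
  have h2 : (8 : ℝ) ≤ Real.exp 3 := by
    have := Real.add_one_le_exp (1 : ℝ)
    calc (8 : ℝ) = 2 ^ 3 := by norm_num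
      _ ≤ Real.exp 1 ^ 3 := by gcongr; linarith
      _ = Real.exp 3 := by rw [← Real.exp_nat_mul]; norm_num
  have h3 : (8 : ℝ) ^ R ≤ Real.exp (3 * R) := by
    calc (8 : ℝ) ^ R ≤ Real.exp 3 ^ R := by gcongr
      _ = _ := by rw [← Real.exp_nat_mul]; ring_nf
  calc 2 * R * (8 ^ R * Real.exp (2 * R))
      ≤ 2 * Real.exp R * (Real.exp (3 * R) * Real.exp (2 * R)) := by gcongr
    _ = 2 * Real.exp (6 * R) := by
      rw [mul_assoc, ← Real.exp_add, ← Real.exp_add]; ring_nf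

/-- The growth bound near the left end of the interval. -/
theorem abs_eval_le_near_zero {n : ℕ} {p : ℝ[X]} (hn : 1 ≤ n) (hdeg : 8 * p.natDegree ≤ n)
    (hp : ∀ k : ℕ, k ≤ n → |p.eval (k : ℝ)| ≤ 1) {x : ℝ} (hx : 0 ≤ x) (hx1 : x ≤ 1) :
    |p.eval x| ≤ 2 * Real.exp (6 + 192 * (p.natDegree : ℝ) ^ 2 / n) := by
  set d := p.natDegree with hd
  set R := 32 * d ^ 2 / n + 1 with hR
  have hR1 : 1 ≤ R := Nat.le_add_left 1 _
  have hRn : 32 * d ^ 2 < R * n := by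
    rw [hR, add_mul, one_mul]
    have := Nat.div_add_mod (32 * d ^ 2) n
    have := Nat.mod_lt (32 * d ^ 2) (by omega : 0 < n)
    nlinarith
  have hJ : d / R * R ≤ d := Nat.div_mul_le_self d R
  have hJ' : d < (d / R + 1) * R := by
    rw [mul_comm]; exact Nat.lt_mul_div_succ d (by omega)
  set J := d / R with hJdef
  have hRle : 2 * R ≤ n + 2 := by
    have h1 : 32 * d ^ 2 / n * n ≤ 32 * d ^ 2 := Nat.div_mul_le_self _ _
    have h2 : 64 * d ^ 2 ≤ n * n := by nlinarith
    have h3 : 2 * (32 * d ^ 2 / n) * n ≤ n * n := by nlinarith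
    have h4 := Nat.le_of_mul_le_mul_right h3 (by omega : 0 < n)
    omega
  have hfit : 8 * R * J ^ 2 + R ≤ n + 1 := by
    have h1 : (J * R) ^ 2 ≤ d ^ 2 := Nat.pow_le_pow_left hJ 2
    have h2 : 4 * (8 * R * J ^ 2) * R ≤ n * R := by nlinarith
    have h3 := Nat.le_of_mul_le_mul_right h2 (by omega : 0 < R)
    omega
  refine (abs_eval_le_of_blocks hJ' hfit hp hx
    (hx1.trans (by exact_mod_cast hR1))).trans ((two_mul_mul_pow_le_exp R).trans ?_)
  have hRr : (R : ℝ) ≤ 32 * (d : ℝ) ^ 2 / n + 1 := by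
    have := @Nat.cast_div_le ℝ _ _ _ (32 * d ^ 2) n
    rw [hR]
    push_cast at this ⊢
    linarith
  gcongr
  calc 6 * (R : ℝ) ≤ 6 * (32 * (d : ℝ) ^ 2 / n + 1) := by gcongr
    _ = _ := by ring

/-- By translation to the integer part of `x`, at least half of the interval remains to the right. -/
theorem abs_eval_le_left_half {n : ℕ} {p : ℝ[X]} (hn : 1 ≤ n) (hdeg : p.natDegree ≤ n)
    (hp : ∀ k : ℕ, k ≤ n → |p.eval (k : ℝ)| ≤ 1) {x : ℝ} (hx : 0 ≤ x) (hxn : 2 * x ≤ n) :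
    |p.eval x| ≤ 2 * Real.exp (6 + 1536 * (p.natDegree : ℝ) ^ 2 / n) := by
  set d := p.natDegree with hd
  have hn0 : (0 : ℝ) < n := by exact_mod_cast hn
  by_cases hsmall : 16 * d ≤ n
  · set m := ⌊x⌋₊ with hm
    have hmx : (m : ℝ) ≤ x := Nat.floor_le hx
    have hxm : x < m + 1 := Nat.lt_floor_add_one x
    have h2m : 2 * m ≤ n := by
      have : 2 * (m : ℝ) ≤ n := by linarith
      exact_mod_cast this
    set q : ℝ[X] := p.comp (X + C (m : ℝ)) with hq
    have hqd : q.natDegree = d := by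
      rw [hq, natDegree_comp, natDegree_X_add_C, mul_one]
    have hqe : ∀ y, q.eval y = p.eval (y + m) := fun y => by simp [hq]
    have h := abs_eval_le_near_zero (n := n - m) (p := q) (by omega) (by rw [hqd]; omega)
      (fun k hk => by
        rw [hqe, ← Nat.cast_add]
        exact hp _ (by omega))
      (x := x - m) (by linarith) (by linarith)
    rw [hqe, sub_add_cancel, hqd] at h
    refine h.trans ?_
    have hnm : (n : ℝ) / 2 ≤ ((n - m : ℕ) : ℝ) := by
      rw [Nat.cast_sub (by omega)]
      have : 2 * (m : ℝ) ≤ n := by exact_mod_cast h2m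
      linarith
    gcongr 2 * Real.exp (6 + ?_)
    calc 192 * (d : ℝ) ^ 2 / ((n - m : ℕ) : ℝ) ≤ 192 * (d : ℝ) ^ 2 / (n / 2) := by gcongr
      _ = 384 * (d : ℝ) ^ 2 / n := by field_simp; ring
      _ ≤ 1536 * (d : ℝ) ^ 2 / n := by gcongr; norm_num
  · -- a single block: all integers of `[0, n]` are nodes
    have h := abs_eval_le_of_blocks (R := n + 1) (J := 0) (n := n) (p := p) (by omega) (by simp) hp
      hx (by push_cast; linarith)
    refine h.trans ((two_mul_mul_pow_le_exp (n + 1)).trans ?_)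
    have h16 : (n : ℝ) ≤ 16 * d := by exact_mod_cast (not_le.1 hsmall).le
    have : 6 * (n : ℝ) ≤ 1536 * (d : ℝ) ^ 2 / n := by
      rw [le_div_iff₀ hn0]
      nlinarith
    gcongr
    push_cast
    linarith

/-- The Coppersmith–Rivlin theorem: a point of the right half of `[0, n]` is reflected into the left
half. The factor `3` in place of `2` makes the inequality strict. -/
theorem exists_isCoppersmithRivlin : ∃ a b : ℝ, IsCoppersmithRivlin a b := by
  refine ⟨3 * Real.exp 6, 1536, by positivity, by norm_num, fun n p hn hdeg hp x hx hxn => ?_⟩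
  have hle : |p.eval x| ≤ 2 * Real.exp (6 + 1536 * (p.natDegree : ℝ) ^ 2 / n) := by
    rcases le_total (2 * x) n with h | h
    · exact abs_eval_le_left_half hn hdeg hp hx h
    · set q : ℝ[X] := p.comp (C (n : ℝ) - X) with hq
      have hqd : q.natDegree = p.natDegree := by
        have : (C (n : ℝ) - X).natDegree = 1 := by
          rw [← natDegree_neg, neg_sub, natDegree_X_sub_C]
        rw [hq, natDegree_comp, this, mul_one]
      have hqe : ∀ y, q.eval y = p.eval (n - y) := fun y => by simp [hq]
      have h' := abs_eval_le_left_half (p := q) hn (by rw [hqd]; exact hdeg)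
        (fun k hk => by
          rw [hqe, ← Nat.cast_sub hk]
          exact hp _ (by omega))
        (x := n - x) (by linarith) (by linarith)
      rwa [hqe, sub_sub_cancel, hqd] at h'
  refine hle.trans_lt ?_
  rw [Real.exp_add, ← mul_assoc]
  have h1 : 0 < Real.exp (1536 * (p.natDegree : ℝ) ^ 2 / n) := Real.exp_pos _
  have h2 : 0 < Real.exp 6 := Real.exp_pos _
  exact mul_lt_mul_of_pos_right (by linarith) h1

/-! ### Growth outside the interval -/

/-- With `z = cosh u`, `T_D z = cosh (D u)` and `u ≤ sinh u = √(z² - 1)`. -/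
theorem chebyshev_T_eval_le_exp (D : ℕ) {z : ℝ} (hz : 1 ≤ z) :
    (Chebyshev.T ℝ D).eval z ≤ Real.exp (D * Real.sqrt (z ^ 2 - 1)) := by
  set u := Real.arcosh z with hu
  have hzu : Real.cosh u = z := Real.cosh_arcosh hz
  have hu0 : 0 ≤ u := Real.arcosh_nonneg hz
  have hs : Real.sqrt (z ^ 2 - 1) = Real.sinh u := by
    rw [← hzu, Real.cosh_sq, add_sub_cancel_right, Real.sqrt_sq (Real.sinh_nonneg_iff.2 hu0)]
  rw [hs, ← hzu, Chebyshev.T_real_cosh]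
  have h1 : Real.cosh (D * u) ≤ Real.exp (D * u) := by
    rw [Real.cosh_eq]
    have : Real.exp (-(D * u)) ≤ Real.exp (D * u) := by
      gcongr
      have : 0 ≤ D * u := by positivity
      linarith
    linarith
  push_cast
  refine h1.trans ?_
  gcongr
  exact Real.self_le_sinh_iff.2 hu0

/-- The common core of both parts: a polynomial that is small at the integers of `[t, N]` cannot
be large at `0`. The Coppersmith–Rivlin bound makes it small on the real interval `[t, N]`, and
from there to `0` a polynomial grows at most like the Chebyshev polynomial. -/
theorem IsCoppersmithRivlin.eval_zero_le {a b : ℝ} (hab : IsCoppersmithRivlin a b) {N t D : ℕ}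
    (htN : t < N) (hDN : D ≤ N - t) {Q : ℝ[X]} (hQ : Q.natDegree ≤ D) {δ : ℝ}
    (hδ : ∀ k : ℕ, t ≤ k → k ≤ N → |Q.eval (k : ℝ)| ≤ δ) :
    Q.eval 0 ≤ δ * (a * Real.exp (b * (D : ℝ) ^ 2 / ((N : ℝ) - t)
      + 4 * D * Real.sqrt (t * N / ((N : ℝ) - t) ^ 2))) := by
  obtain ⟨ha, hb, hCR⟩ := hab
  set n : ℕ := N - t with hn
  have hnr : (N : ℝ) - t = n := by rw [hn, Nat.cast_sub htN.le]
  have hn1 : 1 ≤ n := by omega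
  have hn0 : (0 : ℝ) < n := by exact_mod_cast hn1
  rw [hnr]
  set K := a * Real.exp (b * (D : ℝ) ^ 2 / n) with hK
  have hK0 : 0 < K := by positivity
  set E := Real.exp (4 * D * Real.sqrt (t * N / (n : ℝ) ^ 2)) with hE
  have hE0 : 0 < E := Real.exp_pos _
  -- A bound `η > δ` is positive, so that `Q` can be divided by it.
  have key : ∀ η : ℝ, δ < η → Q.eval 0 ≤ η * (K * E) := by
    intro η hη
    have hη0 : 0 < η :=
      lt_of_le_of_lt ((abs_nonneg _).trans (hδ N htN.le le_rfl)) hη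
    have hreal : ∀ y : ℝ, 0 ≤ y → y ≤ n → |Q.eval (N - y)| ≤ η * K := by
      intro y hy hyn
      set q : ℝ[X] := C η⁻¹ * Q.comp (C (N : ℝ) - X) with hq
      have hqe : ∀ y, q.eval y = η⁻¹ * Q.eval (N - y) := fun y => by simp [hq]
      have hqd : q.natDegree ≤ D := by
        refine (natDegree_C_mul_le _ _).trans ((natDegree_comp_le).trans ?_)
        have : (C (N : ℝ) - X).natDegree ≤ 1 := by
          rw [← natDegree_neg, neg_sub, natDegree_X_sub_C]
        calc _ ≤ Q.natDegree * 1 := by gcongr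
          _ ≤ D := by rwa [mul_one]
      have h := hCR n q hn1 (hqd.trans hDN) (fun k hk => by
        rw [hqe, abs_mul, abs_inv, abs_of_pos hη0, inv_mul_le_one₀ hη0,
          ← Nat.cast_sub (by omega)]
        exact (hδ _ (by omega) (by omega)).trans hη.le) y hy hyn
      rw [hqe, abs_mul, abs_inv, abs_of_pos hη0] at h
      have h2 : a * Real.exp (b * (q.natDegree : ℝ) ^ 2 / n) ≤ K := by
        rw [hK]; gcongr
      rw [← inv_mul_le_iff₀ hη0]
      exact h.le.trans h2
    have hηK : 0 < η * K := by positivity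
    set P : ℝ[X] := C (η * K)⁻¹ * Q.comp (C ((N : ℝ) - n / 2) - C ((n : ℝ) / 2) * X) with hP
    have hPe : ∀ z, P.eval z = (η * K)⁻¹ * Q.eval (N - n * (z + 1) / 2) := fun z => by
      simp only [hP, eval_mul, eval_C, eval_comp, eval_sub, eval_X]
      congr 2; ring
    have hPd : P.degree ≤ D := by
      refine degree_le_of_natDegree_le
        ((natDegree_C_mul_le _ _).trans ((natDegree_comp_le).trans ?_))
      have : (C ((N : ℝ) - n / 2) - C ((n : ℝ) / 2) * X).natDegree ≤ 1 := by
        compute_degree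
      calc _ ≤ Q.natDegree * 1 := by gcongr
        _ ≤ D := by rwa [mul_one]
    have hz : (1 : ℝ) ≤ 2 * N / n - 1 := by
      rw [le_sub_iff_add_le, le_div_iff₀ hn0, ← hnr]
      have : (0 : ℝ) ≤ t := by positivity
      linarith
    have hC := Chebyshev.eval_iterate_derivative_le_of_forall_abs_le_one (k := 0) hz hPd
      (fun z hz => by
        rw [hPe, abs_mul, abs_inv, abs_of_pos hηK, inv_mul_le_one₀ hηK]
        exact hreal _ (by have := hz.1; have : 0 ≤ z + 1 := by linarith
                          positivity)
          (by have := hz.2; rw [div_le_iff₀ two_pos]; gcongr; linarith))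
    simp only [Function.iterate_zero, id] at hC
    have hC2 := hC.trans (chebyshev_T_eval_le_exp D hz)
    have hz0 : (N : ℝ) - n * (2 * N / n - 1 + 1) / 2 = 0 := by field_simp; ring
    have hsq : (D : ℝ) * Real.sqrt ((2 * N / n - 1) ^ 2 - 1) ≤
        4 * D * Real.sqrt (t * N / (n : ℝ) ^ 2) := by
      have e : ((2 * N / n - 1 : ℝ)) ^ 2 - 1 = 2 ^ 2 * (t * N / (n : ℝ) ^ 2) := by
        have : (t : ℝ) = N - n := by rw [← hnr]; ring
        rw [this]; field_simp; ring
      rw [e, Real.sqrt_mul (by norm_num), Real.sqrt_sq (by norm_num)]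
      have : 0 ≤ (D : ℝ) * Real.sqrt (t * N / (n : ℝ) ^ 2) := by positivity
      linarith
    rw [hPe, hz0, inv_mul_le_iff₀ hηK] at hC2
    calc _ ≤ η * K * E := hC2.trans (by rw [hE]; gcongr)
      _ = _ := by ring
  rw [Real.exp_add, ← mul_assoc a, ← div_le_iff₀ (by positivity)]
  refine le_of_forall_gt_imp_ge_of_dense fun η hη => ?_
  rw [div_le_iff₀ (by positivity)]
  exact key η hη

theorem IsCoppersmithRivlin.error_ge {a b : ℝ} (hab : IsCoppersmithRivlin a b) {N t : ℕ}
    (htN : t < N) {s : ℝ[X]} {ε : ℝ} (hs : s.natDegree ≤ N - t) (hs0 : s.eval 0 = 0)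
    (hsk : ∀ k : ℕ, t ≤ k → k ≤ N → 1 - ε ≤ s.eval (k : ℝ) ∧ s.eval (k : ℝ) ≤ 1) :
    1 / a * Real.exp (-(b * (s.natDegree : ℝ) ^ 2 / ((N : ℝ) - t))
      - 4 * s.natDegree * Real.sqrt (t * N / ((N : ℝ) - t) ^ 2)) ≤ ε := by
  have ha : 0 < a := hab.1
  have h := hab.eval_zero_le htN hs (Q := 1 - s)
    ((natDegree_sub_le _ _).trans (by simp)) (δ := ε) (fun k hk hkN => by
      obtain ⟨h1, h2⟩ := hsk k hk hkN
      rw [eval_sub, eval_one, abs_of_nonneg (by linarith)]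
      linarith)
  rw [eval_sub, eval_one, hs0, sub_zero] at h
  rw [← neg_add', Real.exp_neg, one_div, ← mul_inv, inv_le_iff_one_le_mul₀ (by positivity)]
  exact h

/-! ### Low-degree functions of a black-box and symmetrization -/

/-- The functions of a black-box of size `N` that are complex multilinear polynomials of degree at
most `D` in its bits. The black-box is encoded as the set `A` of its solutions, so that the
monomial `∏ j ∈ S, x_j` becomes the indicator of `S ⊆ A`. -/
def lowDegree (N D : ℕ) : Submodule ℂ (Finset (Fin N) → ℂ) :=
  Submodule.span ℂ {f | ∃ S : Finset (Fin N), #S ≤ D ∧ f = fun A => if S ⊆ A then 1 else 0}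

theorem const_mem_lowDegree {N D : ℕ} (c : ℂ) : (fun _ => c) ∈ lowDegree N D := by
  have h : (fun A : Finset (Fin N) => if ∅ ⊆ A then (1 : ℂ) else 0) ∈ lowDegree N D :=
    Submodule.subset_span ⟨∅, by simp, rfl⟩
  convert (lowDegree N D).smul_mem c h using 1
  ext A; simp

theorem lowDegree_mono {N D D' : ℕ} (h : D ≤ D') : lowDegree N D ≤ lowDegree N D' :=
  Submodule.span_mono fun _ ⟨S, hS, hf⟩ => ⟨S, hS.trans h, hf⟩

theorem mul_bit_mem_lowDegree {N D : ℕ} (j : Fin N) {f : Finset (Fin N) → ℂ}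
    (hf : f ∈ lowDegree N D) : (fun A => if j ∈ A then f A else 0) ∈ lowDegree N (D + 1) := by
  induction hf using Submodule.span_induction with
  | mem f hf =>
    obtain ⟨S, hS, rfl⟩ := hf
    refine Submodule.subset_span ⟨insert j S, (card_insert_le _ _).trans (by omega), ?_⟩
    ext A
    simp only [insert_subset_iff, ite_and]
  | zero => simpa using const_mem_lowDegree 0
  | add f g _ _ ihf ihg =>
    convert Submodule.add_mem _ ihf ihg using 1
    ext A; simp only [Pi.add_apply]; split_ifs <;> simp
  | smul c f _ ih =>
    convert Submodule.smul_mem _ c ih using 1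
    ext A; simp only [Pi.smul_apply]; split_ifs <;> simp

theorem choose_mul_descFactorial {N k s : ℕ} (hs : s ≤ k) :
    N.choose k * k.descFactorial s = N.descFactorial s * (N - s).choose (k - s) := by
  rw [Nat.descFactorial_eq_factorial_mul_choose, Nat.descFactorial_eq_factorial_mul_choose]
  have := Nat.choose_mul (n := N) hs
  calc _ = s.factorial * (N.choose k * k.choose s) := by ring
    _ = _ := by rw [this]; ring

/-- Symmetrization: the average over all black-boxes with `k` solutions is a polynomial in `k`. -/
theorem exists_complex_average {N D : ℕ} {f : Finset (Fin N) → ℂ} (hf : f ∈ lowDegree N D) :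
    ∃ Q : ℂ[X], Q.natDegree ≤ D ∧ ∀ k : ℕ, k ≤ N →
      ∑ A ∈ powersetCard k univ, f A = N.choose k * Q.eval (k : ℂ) := by
  induction hf using Submodule.span_induction with
  | mem f hf =>
    obtain ⟨S, hS, rfl⟩ := hf
    have hSN : #S ≤ N := by simpa using card_le_univ S
    have hN0 : (N.descFactorial #S : ℂ) ≠ 0 := by
      exact_mod_cast (Nat.descFactorial_pos.2 hSN).ne'
    refine ⟨C (N.descFactorial #S : ℂ)⁻¹ * descPochhammer ℂ #S, ?_, fun k hk => ?_⟩
    · refine (natDegree_C_mul_le _ _).trans ?_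
      rwa [descPochhammer_natDegree]
    · rw [eval_mul, eval_C, descPochhammer_eval_eq_descFactorial, ← sum_filter, sum_const,
        nsmul_eq_mul, mul_one]
      rcases lt_or_ge k #S with hlt | hge
      · rw [Nat.descFactorial_eq_zero_iff_lt.2 hlt, filter_eq_empty_iff.2]
        · simp
        · intro A hA hSA
          have := card_le_card hSA
          rw [(mem_powersetCard.1 hA).2] at this
          omega
      · have hcard : #((powersetCard k (univ : Finset (Fin N))).filter (S ⊆ ·)) =
            (N - #S).choose (k - #S) := by
          rw [card_filter_powersetCard_subset _ _ _ (subset_univ _) hge]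
          simp
        have h := choose_mul_descFactorial (N := N) hge
        have h' : (N.choose k : ℂ) * k.descFactorial #S =
            N.descFactorial #S * (N - #S).choose (k - #S) := by exact_mod_cast h
        rw [hcard, mul_left_comm, h', inv_mul_cancel_left₀ hN0]
  | zero => exact ⟨0, by simp, by simp⟩
  | add f g _ _ ihf ihg =>
    obtain ⟨P, hP, hP'⟩ := ihf
    obtain ⟨Q, hQ, hQ'⟩ := ihg
    refine ⟨P + Q, natDegree_add_le_of_degree_le hP hQ, fun k hk => ?_⟩
    simp only [Pi.add_apply, sum_add_distrib, eval_add, mul_add, hP' k hk, hQ' k hk]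
  | smul c f _ ih =>
    obtain ⟨P, hP, hP'⟩ := ih
    refine ⟨C c * P, (natDegree_C_mul_le _ _).trans hP, fun k hk => ?_⟩
    simp only [Pi.smul_apply, smul_eq_mul, ← mul_sum, hP' k hk, eval_mul, eval_C]
    ring

/-- Averages of real parts: the polynomial is obtained by taking real parts of coefficients. -/
theorem exists_real_average {N D : ℕ} {f : Finset (Fin N) → ℂ} (hf : f ∈ lowDegree N D) :
    ∃ Q : ℝ[X], Q.natDegree ≤ D ∧ ∀ k : ℕ, k ≤ N →
      ∑ A ∈ powersetCard k univ, (f A).re = N.choose k * Q.eval (k : ℝ) := by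
  obtain ⟨P, hP, hP'⟩ := exists_complex_average hf
  refine ⟨∑ i ∈ range (D + 1), C (P.coeff i).re * X ^ i, ?_, fun k hk => ?_⟩
  · refine natDegree_sum_le_of_forall_le _ _ fun i hi => ?_
    exact (natDegree_C_mul_X_pow_le _ _).trans (by have := mem_range.1 hi; omega)
  · have h := congrArg Complex.re (hP' k hk)
    rw [Complex.re_sum] at h
    rw [h, eval_eq_sum_range' (Nat.lt_succ_of_le hP), eval_finsetSum, ← Complex.ofReal_natCast,
      Complex.re_ofReal_mul, Complex.re_sum]
    congr 1
    refine sum_congr rfl fun i _ => ?_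
    simp only [eval_mul, eval_C, eval_pow, eval_X]
    rw [← Complex.ofReal_natCast, ← Complex.ofReal_pow, Complex.re_mul_ofReal]

/-- Vectors with components of degree at most `D` that have squared norm at least `1 - ε` when
there are no solutions and at most `ε` when there are at least `t` of them. The projection onto the
vector for no solutions turns the vectors into a scalar polynomial; working with amplitudes, not
probabilities, is what keeps the degree down to `D`. -/
theorem IsCoppersmithRivlin.amplitude_error_ge {a b : ℝ} (hab : IsCoppersmithRivlin a b)
    {N t D : ℕ} (htN : t < N) (hDN : D ≤ N - t) {ι : Type*} [Fintype ι]
    {f : Finset (Fin N) → ι → ℂ} (hf : ∀ s, (fun A => f A s) ∈ lowDegree N D) {ε : ℝ}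
    (h0 : 1 - ε ≤ ∑ s, ‖f ∅ s‖ ^ 2) (hA : ∀ A, t ≤ #A → ∑ s, ‖f A s‖ ^ 2 ≤ ε) :
    min (1 / 2) (1 / (2 * a ^ 2)) * Real.exp (-(4 * b * (D : ℝ) ^ 2 / ((N : ℝ) - t))
      - 8 * D * Real.sqrt (t * N / ((N : ℝ) - t) ^ 2)) ≤ ε := by
  have ha : 0 < a := hab.1
  have hb : 0 < b := hab.2.1
  have hn0 : (0 : ℝ) < (N : ℝ) - t := sub_pos.2 (by exact_mod_cast htN)
  set r := Real.sqrt (t * N / ((N : ℝ) - t) ^ 2) with hr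
  have hr0 : 0 ≤ r := Real.sqrt_nonneg _
  set y := b * (D : ℝ) ^ 2 / ((N : ℝ) - t) with hy
  have hy0 : 0 ≤ y := by positivity
  have hε0 : 0 ≤ ε := (sum_nonneg fun s _ => by positivity).trans
    (hA univ (by simpa using htN.le))
  have hexp : -(4 * b * (D : ℝ) ^ 2 / ((N : ℝ) - t)) - 8 * D * r = -(4 * y + 8 * D * r) := by
    rw [hy]; ring
  rw [hexp]
  have hDr : 0 ≤ D * r := by positivity
  -- An error of at least `1 / 2` satisfies the bound because the exponential is at most `1`.
  rcases le_or_gt (1 / 2) ε with hbig | hsmall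
  · calc _ ≤ (1 / 2 : ℝ) * 1 := by
          gcongr
          · exact min_le_left _ _
          · rw [Real.exp_le_one_iff]; linarith
      _ ≤ ε := by linarith
  set W := ∑ s, ‖f ∅ s‖ ^ 2 with hW
  have hW2 : 1 / 2 ≤ W := by linarith
  -- By Cauchy–Schwarz, `|β A|² ≤ W ε` on the black-boxes with at least `t` solutions.
  set β : Finset (Fin N) → ℂ := fun A => ∑ s, star (f ∅ s) * f A s with hβ
  have hβmem : β ∈ lowDegree N D := by
    have e : β = ∑ s, star (f ∅ s) • (fun A => f A s) := by
      ext A; simp [hβ]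
    rw [e]
    exact Submodule.sum_mem _ fun s _ => Submodule.smul_mem _ _ (hf s)
  have hβ0 : (β ∅).re = W := by
    have : β ∅ = ((W : ℝ) : ℂ) := by
      rw [hW, Complex.ofReal_sum]
      refine sum_congr rfl fun s _ => ?_
      rw [Complex.star_def, ← Complex.normSq_eq_conj_mul_self, Complex.normSq_eq_norm_sq]
    rw [this, Complex.ofReal_re]
  have hβA : ∀ A, t ≤ #A → |(β A).re| ≤ Real.sqrt (W * ε) := fun A ht => by
    refine (Complex.abs_re_le_norm _).trans (Real.le_sqrt_of_sq_le ?_)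
    have h1 : ‖β A‖ ≤ ∑ s, ‖f ∅ s‖ * ‖f A s‖ := by
      refine (norm_sum_le _ _).trans (le_of_eq (sum_congr rfl fun s _ => ?_))
      rw [norm_mul, norm_star]
    calc ‖β A‖ ^ 2 ≤ (∑ s, ‖f ∅ s‖ * ‖f A s‖) ^ 2 := by gcongr
      _ ≤ W * ∑ s, ‖f A s‖ ^ 2 := sum_mul_sq_le_sq_mul_sq _ _ _
      _ ≤ W * ε := by gcongr; exact hA A ht
  obtain ⟨Q, hQ, hQk⟩ := exists_real_average hβmem
  have hQ0 : Q.eval 0 = W := by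
    have := hQk 0 (Nat.zero_le _)
    simpa [hβ0] using this.symm
  have hQb : ∀ k : ℕ, t ≤ k → k ≤ N → |Q.eval (k : ℝ)| ≤ Real.sqrt (W * ε) := by
    intro k hk hkN
    have hc : (0 : ℝ) < N.choose k := by exact_mod_cast Nat.choose_pos hkN
    have h1 : |∑ A ∈ powersetCard k (univ : Finset (Fin N)), (β A).re| ≤
        N.choose k * Real.sqrt (W * ε) := by
      refine (abs_sum_le_sum_abs _ _).trans ?_
      refine (sum_le_card_nsmul _ _ (Real.sqrt (W * ε)) fun A hAk => hβA A ?_).trans ?_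
      · rw [(mem_powersetCard.1 hAk).2]; exact hk
      · rw [card_powersetCard, card_univ, Fintype.card_fin, nsmul_eq_mul]
    rw [hQk k hkN, abs_mul, abs_of_pos hc] at h1
    exact le_of_mul_le_mul_left h1 hc
  have hcore := hab.eval_zero_le htN hDN hQ hQb
  rw [hQ0, ← hr, ← hy] at hcore
  have hsq : W ^ 2 ≤ W * (ε * (a ^ 2 * Real.exp (2 * y + 8 * D * r))) := by
    calc W ^ 2 ≤ (Real.sqrt (W * ε) * (a * Real.exp (y + 4 * D * r))) ^ 2 := by gcongr
      _ = _ := by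
        rw [mul_pow, Real.sq_sqrt (by positivity), mul_pow, ← Real.exp_nat_mul]
        ring_nf
  have hWle : W ≤ ε * (a ^ 2 * Real.exp (2 * y + 8 * D * r)) := by
    rw [sq] at hsq
    exact le_of_mul_le_mul_left hsq (by linarith)
  calc _ ≤ 1 / (2 * a ^ 2) * Real.exp (-(2 * y + 8 * D * r)) := by
        gcongr
        · exact min_le_right _ _
        · norm_num
    _ = (1 / 2) / (a ^ 2 * Real.exp (2 * y + 8 * D * r)) := by
        rw [Real.exp_neg]; field_simp
    _ ≤ ε := by
        rw [div_le_iff₀ (by positivity)]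
        linarith

/-! ### Amplitudes of query algorithms -/

namespace QueryAlgorithm

/-- The black-box whose set of solutions is `A`. -/
def blackBox {N : ℕ} (A : Finset (Fin N)) : Fin N → Bool := fun j => decide (j ∈ A)

theorem blackBox_empty {N : ℕ} : blackBox (∅ : Finset (Fin N)) = fun _ => false := by
  funext j; simp [blackBox]

theorem filter_blackBox {N : ℕ} (S : Finset (Fin N)) :
    (univ.filter fun j => blackBox S j = true) = S := by
  ext j; simp [blackBox]

variable {N T : ℕ} {Out : Type}

theorem state_succ (A : QueryAlgorithm N T Out) (x : Fin N → Bool) (i : Fin T) :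
    A.state x i.succ =
      Matrix.mulVec (A.U i.succ : Matrix A.Basis A.Basis ℂ) (A.query x (A.state x i.castSucc)) :=
  rfl

theorem queryBasis_involutive (A : QueryAlgorithm N T Out) (x : Fin N → Bool) :
    Function.Involutive (A.queryBasis x) := by
  rintro ⟨j, b, z⟩
  simp [queryBasis]

/-- Each query raises the degree of the amplitudes by at most one. -/
theorem state_mem_lowDegree (A : QueryAlgorithm N T Out) (k : Fin (T + 1)) (s : A.Basis) :
    (fun S => A.state (blackBox S) k s) ∈ lowDegree N k := by
  induction k using Fin.induction generalizing s with
  | zero => exact const_mem_lowDegree _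
  | succ i ih =>
    have hq : ∀ s, (fun S => A.query (blackBox S) (A.state (blackBox S) i.castSucc) s) ∈
        lowDegree N i.succ := by
      rintro ⟨j, b, z⟩
      have hmono : lowDegree N i.castSucc ≤ lowDegree N i.succ := lowDegree_mono (by simp)
      by_cases hj : (j : ℕ) < N
      · have h1 := hmono (ih (j, b, z))
        have h2 := mul_bit_mem_lowDegree ⟨j, hj⟩
          (Submodule.sub_mem _ (ih (j, !b, z)) (ih (j, b, z)))
        convert Submodule.add_mem _ h1 h2 using 1
        ext S
        by_cases hS : (⟨j, hj⟩ : Fin N) ∈ S <;> simp [query, queryBasis, blackBox, hj, hS]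
      · convert hmono (ih (j, b, z)) using 1
        ext S
        simp [query, queryBasis, hj]
    have e : (fun S => A.state (blackBox S) i.succ s) = ∑ s', (A.U i.succ).1 s s' •
        (fun S => A.query (blackBox S) (A.state (blackBox S) i.castSucc) s') := by
      ext S
      simp [state_succ, Matrix.mulVec, dotProduct]
    rw [e]
    exact Submodule.sum_mem _ fun s' _ => Submodule.smul_mem _ _ (hq s')

theorem sum_norm_sq_unitary_mulVec {n : Type*} [Fintype n] [DecidableEq n]
    (U : Matrix.unitaryGroup n ℂ) (v : n → ℂ) :
    ∑ s, ‖Matrix.mulVec (U : Matrix n n ℂ) v s‖ ^ 2 = ∑ s, ‖v s‖ ^ 2 := by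
  have e : ∀ w : n → ℂ, ((∑ s, ‖w s‖ ^ 2 : ℝ) : ℂ) = star w ⬝ᵥ w := fun w => by
    rw [Complex.ofReal_sum]
    refine sum_congr rfl fun s _ => ?_
    rw [Pi.star_apply, Complex.star_def, ← Complex.normSq_eq_conj_mul_self,
      Complex.normSq_eq_norm_sq]
  have h : star (U : Matrix n n ℂ) * U = 1 := Matrix.UnitaryGroup.star_mul_self U
  apply Complex.ofReal_injective
  rw [e, e, Matrix.star_mulVec, ← Matrix.dotProduct_mulVec, Matrix.mulVec_mulVec,
    ← Matrix.star_eq_conjTranspose, h, Matrix.one_mulVec]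

theorem sum_norm_sq_state (A : QueryAlgorithm N T Out) (x : Fin N → Bool) (k : Fin (T + 1)) :
    ∑ s, ‖A.state x k s‖ ^ 2 = 1 := by
  induction k using Fin.induction with
  | zero =>
    change ∑ s, ‖Matrix.mulVec (A.U 0 : Matrix A.Basis A.Basis ℂ)
      (Pi.single (0, false, 0) 1) s‖ ^ 2 = 1
    rw [sum_norm_sq_unitary_mulVec]
    rw [sum_eq_single ((0, false, 0) : A.Basis)]
    · simp
    · intro s _ hs; simp [hs]
    · simp
  | succ i ih =>
    rw [state_succ, sum_norm_sq_unitary_mulVec, ← ih]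
    exact Equiv.sum_comp (A.queryBasis_involutive x).toPerm
      (fun s => ‖A.state x i.castSucc s‖ ^ 2)

open Classical in
/-- The part of the final state, on black-box `x`, whose measurement gives an answer in `E`. -/
def finalPart (A : QueryAlgorithm N T Out) (x : Fin N → Bool) (E : Set Out) : A.Basis → ℂ :=
  fun s => if A.out s ∈ E then A.state x (Fin.last T) s else 0

theorem finalPart_of_mem {A : QueryAlgorithm N T Out} {x : Fin N → Bool} {E : Set Out}
    {s : A.Basis} (h : A.out s ∈ E) : A.finalPart x E s = A.state x (Fin.last T) s :=
  if_pos h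

theorem finalPart_of_notMem {A : QueryAlgorithm N T Out} {x : Fin N → Bool} {E : Set Out}
    {s : A.Basis} (h : A.out s ∉ E) : A.finalPart x E s = 0 :=
  if_neg h

theorem sum_norm_sq_finalPart (A : QueryAlgorithm N T Out) (x : Fin N → Bool) (E : Set Out) :
    ∑ s, ‖A.finalPart x E s‖ ^ 2 = A.prob x E := by
  refine sum_congr rfl fun s _ => ?_
  unfold finalPart
  split_ifs <;> simp

theorem prob_add_prob_le_one (A : QueryAlgorithm N T Out) (x : Fin N → Bool) {E F : Set Out}
    (h : Disjoint E F) : A.prob x E + A.prob x F ≤ 1 := by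
  classical
  rw [← A.sum_norm_sq_state x (Fin.last T), prob, prob, ← sum_add_distrib]
  refine sum_le_sum fun s _ => ?_
  by_cases hE : A.out s ∈ E
  · rw [if_pos hE, if_neg (Set.disjoint_left.1 h hE), add_zero]
  · rw [if_neg hE, zero_add]
    split_ifs
    · exact le_rfl
    · positivity

theorem prob_compl (A : QueryAlgorithm N T Out) (x : Fin N → Bool) (E : Set Out) :
    A.prob x Eᶜ = 1 - A.prob x E := by
  classical
  rw [← A.sum_norm_sq_state x (Fin.last T), prob, prob, ← sum_sub_distrib]
  refine sum_congr rfl fun s _ => ?_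
  by_cases hE : A.out s ∈ E <;> simp [hE]

end QueryAlgorithm

/-- The relevant amplitudes are those of the answer "no". -/
theorem IsCoppersmithRivlin.search_error_ge {a b : ℝ} (hab : IsCoppersmithRivlin a b)
    {N t T : ℕ} (htN : t < N) (hT : T ≤ N - t) (A : QueryAlgorithm N T (Option (Fin N))) {ε : ℝ}
    (h : SearchesWithError A t ε) :
    min (1 / 2) (1 / (2 * a ^ 2)) * Real.exp (-(4 * b * (T : ℝ) ^ 2 / ((N : ℝ) - t))
      - 8 * T * Real.sqrt (t * N / ((N : ℝ) - t) ^ 2)) ≤ ε := by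
  refine hab.amplitude_error_ge htN hT (f := fun S =>
    A.finalPart (QueryAlgorithm.blackBox S) {none}) (fun s => ?_) ?_ fun S hS => ?_
  · by_cases hs : A.out s ∈ ({none} : Set (Option (Fin N)))
    · simp only [QueryAlgorithm.finalPart_of_mem hs]
      exact A.state_mem_lowDegree (Fin.last T) s
    · simp only [QueryAlgorithm.finalPart_of_notMem hs]
      exact const_mem_lowDegree 0
  · rw [A.sum_norm_sq_finalPart]
    rw [QueryAlgorithm.blackBox_empty]
    exact h.1
  · rw [A.sum_norm_sq_finalPart]
    have h1 := h.2 (QueryAlgorithm.blackBox S) (by rwa [QueryAlgorithm.filter_blackBox])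
    have h2 := A.prob_add_prob_le_one (QueryAlgorithm.blackBox S)
      (E := {none}) (F := solutions (QueryAlgorithm.blackBox S)) (by
        rw [Set.disjoint_singleton_left]
        rintro ⟨j, hj, -⟩
        cases hj)
    linarith

/-- An answer `some j` fails where the bit `x_j` is zero, so the failing amplitudes are the final
ones times `1 - x_j`, of degree `T + 1`. Without solutions every answer fails, whatever the
algorithm does. -/
theorem IsCoppersmithRivlin.find_error_ge {a b : ℝ} (hab : IsCoppersmithRivlin a b)
    {N t T : ℕ} (htN : t < N) (hT : T + 1 ≤ N - t) (A : QueryAlgorithm N T (Option (Fin N)))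
    {ε : ℝ} (h : FindsWithError A t ε) :
    min (1 / 2) (1 / (2 * a ^ 2)) * Real.exp (-(4 * b * ((T : ℝ) + 1) ^ 2 / ((N : ℝ) - t))
      - 8 * ((T : ℝ) + 1) * Real.sqrt (t * N / ((N : ℝ) - t) ^ 2)) ≤ ε := by
  have hfail : ∀ S, t ≤ #S → A.prob (QueryAlgorithm.blackBox S)
      (solutions (QueryAlgorithm.blackBox S))ᶜ ≤ ε := fun S hS => by
    have := h (QueryAlgorithm.blackBox S) (by rwa [QueryAlgorithm.filter_blackBox])
    rw [A.prob_compl]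
    linarith
  have := hab.amplitude_error_ge htN hT (ε := ε) (f := fun S =>
    A.finalPart (QueryAlgorithm.blackBox S) (solutions (QueryAlgorithm.blackBox S))ᶜ)
    (fun s => ?_) ?_ fun S hS => ?_
  · push_cast at this
    exact this
  · have hstate := A.state_mem_lowDegree (Fin.last T) s
    have hstate' := lowDegree_mono (Nat.le_succ _) hstate
    rcases hout : A.out s with _ | j
    · have e : ∀ S, A.finalPart (QueryAlgorithm.blackBox S)
          (solutions (QueryAlgorithm.blackBox S))ᶜ s =
          A.state (QueryAlgorithm.blackBox S) (Fin.last T) s := fun S =>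
        QueryAlgorithm.finalPart_of_mem (by rw [hout]; simp [solutions])
      simp only [e]
      exact hstate'
    · have e : (fun S => A.finalPart (QueryAlgorithm.blackBox S)
          (solutions (QueryAlgorithm.blackBox S))ᶜ s) =
          (fun S => A.state (QueryAlgorithm.blackBox S) (Fin.last T) s) - fun S =>
            if j ∈ S then A.state (QueryAlgorithm.blackBox S) (Fin.last T) s else 0 := by
        funext S
        rw [Pi.sub_apply]
        by_cases hj : j ∈ S
        · rw [QueryAlgorithm.finalPart_of_notMem
            (by rw [hout]; simp [solutions, QueryAlgorithm.blackBox, hj]), if_pos hj, sub_self]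
        · rw [QueryAlgorithm.finalPart_of_mem
            (by rw [hout]; simp [solutions, QueryAlgorithm.blackBox, hj]), if_neg hj, sub_zero]
      rw [e]
      exact Submodule.sub_mem _ hstate' (mul_bit_mem_lowDegree j hstate)
  · rw [A.sum_norm_sq_finalPart]
    have hempty : solutions (QueryAlgorithm.blackBox (∅ : Finset (Fin N))) = ∅ := by
      ext o; simp [solutions, QueryAlgorithm.blackBox]
    have hε : 0 ≤ ε := by
      refine le_trans ?_ (hfail univ (by simpa using htN.le))
      exact sum_nonneg fun s _ => by split_ifs <;> positivity
    have h0 : A.prob (QueryAlgorithm.blackBox (∅ : Finset (Fin N))) ∅ = 0 := by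
      simp [QueryAlgorithm.prob]
    rw [A.prob_compl, hempty, h0]
    linarith
  · rw [A.sum_norm_sq_finalPart]
    exact hfail S hS

end

theorem theorem2 :
    (∃ a b : ℝ, IsCoppersmithRivlin a b) ∧
    ∀ a b : ℝ, IsCoppersmithRivlin a b →
      -- the polynomial bound
      (∀ (N t : ℕ) (s : Polynomial ℝ) (ε : ℝ), 1 ≤ t → t < N → s.natDegree ≤ N - t →
        s.eval 0 = 0 →
        (∀ k : ℕ, t ≤ k → k ≤ N → 1 - ε ≤ s.eval (k : ℝ) ∧ s.eval (k : ℝ) ≤ 1) →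
        1 / a * Real.exp (-(b * (s.natDegree : ℝ) ^ 2 / ((N : ℝ) - t))
          - 4 * s.natDegree * Real.sqrt (t * N / ((N : ℝ) - t) ^ 2)) ≤ ε) ∧
      -- the bound for quantum search, with a constant that does not depend on `N`, `t`, `T`
      ∃ c : ℝ, 0 < c ∧
        (∀ (N t T : ℕ), 1 ≤ t → t < N → T ≤ N - t →
          ∀ (A : QueryAlgorithm N T (Option (Fin N))) (ε : ℝ), SearchesWithError A t ε →
            c * Real.exp (-(4 * b * (T : ℝ) ^ 2 / ((N : ℝ) - t))
              - 8 * T * Real.sqrt (t * N / ((N : ℝ) - t) ^ 2)) ≤ ε) ∧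
        -- the same for algorithms that may do anything on the all-zero black-box; the total
        -- `T + 1` includes one query that tests the returned index
        (∀ (N t T : ℕ), 1 ≤ t → t < N → T + 1 ≤ N - t →
          ∀ (A : QueryAlgorithm N T (Option (Fin N))) (ε : ℝ), FindsWithError A t ε →
            c * Real.exp (-(4 * b * ((T : ℝ) + 1) ^ 2 / ((N : ℝ) - t))
              - 8 * ((T : ℝ) + 1) * Real.sqrt (t * N / ((N : ℝ) - t) ^ 2)) ≤ ε) := by
  refine ⟨exists_isCoppersmithRivlin, fun a b hab =>
    ⟨fun N t s ε _ htN hs hs0 hsk => hab.error_ge htN hs hs0 hsk,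
      min (1 / 2) (1 / (2 * a ^ 2)), ?_, ?_, ?_⟩⟩
  · have := hab.1
    positivity
  · exact fun N t T _ htN hT A ε h => hab.search_error_ge htN hT A h
  · exact fun N t T _ htN hT A ε h => hab.find_error_ge htN hT A h
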